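/- Let $H$ be an infinite-dimensional separable Hilbert space (over $\mathbb{R}$ or $\mathbb{C}$), let $\ell^2$ be the space of square-summable scalar sequences indexed by $\mathbb{N}$, and let $\mathcal{F} = (x_n)_{n\in\mathbb{N}}$ be a frame for $H$, that is, there are constants $0 < A \le B$ with $A\|x\|^2 \le \sum_{n} |\langle x, x_n\rangle|^2 \le B\|x\|^2$ for all $x \in H$. A sequence $\mathcal{Y} = (y_n)_{n\in\mathbb{N}}$ in $H$ is an alternative dual of $\mathcal{F}$ if $x = \sum_{n} \langle x, y_n\rangle x_n$ for every $x \in H$, where the series converges in the norm as a limit of its successive partial sums. The extended moment space of $\mathcal{F}$ is $$\mathcal{M}(\mathcal{F}) = \bigcup \bigl\{ m(\mathcal{Y}) : \mathcal{Y} \text{ is an alternative dual of } \mathcal{F}\bigr\}, \qquad m(\mathcal{Y}) = \bigl\{ (\langle x, y_n\rangle)_{n\in\mathbb{N}} : x \in H \bigr\}.$$ A family in $H$ is a Riesz basis if it is the image of an orthonormal basis for $H$ under a continuous linear bijection of $H$ onto itself, and $\mathcal{F}$ is a near-Riesz basis if there is a finite set $F \subseteq \mathbb{N}$ such that $(x_n)_{n\notin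 F}$ is a Riesz basis. Theorem 3.15. $\mathcal{M}(\mathcal{F}) \subseteq \ell^2$ if and only if $\mathcal{F}$ is a near-Riesz basis. Moreover, $\mathcal{M}(\mathcal{F}) = \ell^2$ if and only if $\mathcal{F}$ is a Riesz basis. -/

import Mathlib

open Filter Topology


/-- The sequence `x` is a frame: there are bounds `0 < A ≤ B` such that, for all `v`, the series
`∑ |⟨v, x n⟩|²` converges and lies between `A ‖v‖²` and `B ‖v‖²`. -/
def IsFrame (𝕜 : Type*) [RCLike 𝕜] {H : Type*} [NormedAddCommGroup H] [InnerProductSpace 𝕜 H]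
    (x : ℕ → H) : Prop :=
  ∃ A B : ℝ, 0 < A ∧ A ≤ B ∧ ∀ v : H,
    Summable (fun n => ‖inner 𝕜 (x n) v‖ ^ 2) ∧
    A * ‖v‖ ^ 2 ≤ ∑' n, ‖inner 𝕜 (x n) v‖ ^ 2 ∧
    ∑' n, ‖inner 𝕜 (x n) v‖ ^ 2 ≤ B * ‖v‖ ^ 2

/-- The family `x` is a Riesz basis: the image of an orthonormal basis of `H` under a continuous
linear bijection of `H` onto itself. -/
def IsRieszBasis (𝕜 : Type*) [RCLike 𝕜] {H : Type*} [NormedAddCommGroup H]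
    [InnerProductSpace 𝕜 H] {ι : Type*} (x : ι → H) : Prop :=
  ∃ (e : HilbertBasis ι 𝕜 H) (T : H →L[𝕜] H), Function.Bijective T ∧ ∀ i, x i = T (e i)

/-- The sequence `x` is a near-Riesz basis: it becomes a Riesz basis after removal of the terms
whose index lies in some finite set. -/
def IsNearRieszBasis (𝕜 : Type*) [RCLike 𝕜] {H : Type*} [NormedAddCommGroup H]
    [InnerProductSpace 𝕜 H] (x : ℕ → H) : Prop :=
  ∃ F : Finset ℕ, IsRieszBasis 𝕜 (fun n : {n : ℕ // n ∉ F} => x n)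

/-- The sequence `y` is an alternative dual of `x`: for every `v`, the partial sums of
`∑ ⟨v, y n⟩ x n` converge to `v`. The inner product of Mathlib is linear in its second argument,
so the coefficient is `inner 𝕜 (y n) v`. Convergence need not be unconditional. -/
def IsAlternativeDual (𝕜 : Type*) [RCLike 𝕜] {H : Type*} [NormedAddCommGroup H]
    [InnerProductSpace 𝕜 H] (x y : ℕ → H) : Prop :=
  ∀ v : H, Tendsto (fun N => ∑ n ∈ Finset.range N, inner 𝕜 (y n) v • x n) atTop (𝓝 v)

/-- The moment space of `y`: all the scalar sequences `n ↦ ⟨v, y n⟩` with `v ∈ H`. -/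
def momentSpace (𝕜 : Type*) [RCLike 𝕜] {H : Type*} [NormedAddCommGroup H]
    [InnerProductSpace 𝕜 H] (y : ℕ → H) : Set (ℕ → 𝕜) :=
  {c | ∃ v : H, c = fun n => inner 𝕜 (y n) v}

/-- The union of the moment spaces of all alternative duals of `x`. -/
def extendedMomentSpace (𝕜 : Type*) [RCLike 𝕜] {H : Type*} [NormedAddCommGroup H]
    [InnerProductSpace 𝕜 H] (x : ℕ → H) : Set (ℕ → 𝕜) :=
  ⋃ y ∈ {y : ℕ → H | IsAlternativeDual 𝕜 x y}, momentSpace 𝕜 y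

/-- The set `ℓ²` of square-summable scalar sequences. -/
def squareSummable (𝕜 : Type*) [RCLike 𝕜] : Set (ℕ → 𝕜) :=
  {c | Summable (fun n => ‖c n‖ ^ 2)}

/-!
Let `T : ℓ² → H`, `c ↦ ∑ c n • x n`, be the synthesis operator of the frame `x`. The lower frame
bound makes `T` surjective, with a bounded right inverse `v ↦ (⟨v, y n⟩)` coming from the canonical
dual `y` (`IsFrame.exists_dual`). Everything depends on the size of the kernel of `T`.

* If `ker T` is infinite-dimensional, then it contains unit vectors that are essentially
  concentrated on finite sets of indices arbitrarily far out (`exists_block`). Placing such blocks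
  one after the other, the `j`-th one scaled by `1 / √(j + 1)`, gives `c ∉ ℓ²` for which
  `∑ c n • x n` converges (`exists_tendsto_not_summable`). A rank-one perturbation of the canonical
  dual turns `c` into an element of the extended moment space outside `ℓ²`
  (`IsFrame.not_extendedMomentSpace_subset`).
* If `ker T` is finite-dimensional, then deleting finitely many indices, one for each dimension of
  the kernel, makes `T` bijective (`exists_finset_bijective`), and a family with bijective synthesis
  operator is a Riesz basis (`isRieszBasis_of_synthesis_bijective`).

Conversely, the coefficients of any convergent expansion in a near-Riesz basis are square-summable,
because after inverting the operator that defines the Riesz basis all but finitely many of them are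
coefficients in an orthonormal basis (`IsNearRieszBasis.summable_of_tendsto`).

For the equality with `ℓ²`, note that an element `c` of `ker T` in the extended moment space is of
the form `c n = ⟨v, y n⟩` for some dual `y`, so that `v = ∑ c n • x n = 0` and `c = 0`. Hence equality
forces `T` to be injective. Conversely the dual of a Riesz basis has all of `ℓ²` as its moment space
(`IsRieszBasis.squareSummable_subset`).
-/

/-- The family `x` is a Bessel family: `∑ |⟨v, x i⟩|²` converges for every `v` and is bounded by a
constant multiple of `‖v‖²`. -/
def IsBessel (𝕜 : Type*) [RCLike 𝕜] {H : Type*} [NormedAddCommGroup H] [InnerProductSpace 𝕜 H]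
    {ι : Type*} (x : ι → H) : Prop :=
  ∃ B : ℝ, ∀ v : H, Summable (fun i => ‖inner 𝕜 (x i) v‖ ^ 2) ∧
    ∑' i, ‖inner 𝕜 (x i) v‖ ^ 2 ≤ B * ‖v‖ ^ 2

section

variable {𝕜 : Type*} [RCLike 𝕜] {H : Type*} [NormedAddCommGroup H] [InnerProductSpace 𝕜 H]
  {ι : Type*}

theorem IsFrame.isBessel {x : ℕ → H} (hx : IsFrame 𝕜 x) : IsBessel 𝕜 x := by
  obtain ⟨A, B, -, -, h⟩ := hx
  exact ⟨B, fun v => ⟨(h v).1, (h v).2.2⟩⟩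

theorem IsBessel.subtype {x : ι → H} (hx : IsBessel 𝕜 x) (p : ι → Prop) :
    IsBessel 𝕜 (fun i : {i // p i} => x i) := by
  obtain ⟨B, h⟩ := hx
  refine ⟨B, fun v => ⟨(h v).1.subtype {i | p i}, le_trans ?_ (h v).2⟩⟩
  exact (h v).1.tsum_subtype_le (fun i => ‖inner 𝕜 (x i) v‖ ^ 2) {i | p i} (fun i => by positivity)

/-! ### Square-summable sequences -/

theorem memℓp_two_iff {c : ι → 𝕜} : Memℓp c 2 ↔ Summable (fun i => ‖c i‖ ^ 2) := by
  rw [memℓp_gen_iff (by norm_num)]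
  simp

theorem lp_two_summable (c : lp (fun _ : ι => 𝕜) 2) : Summable (fun i => ‖c i‖ ^ 2) :=
  memℓp_two_iff.1 c.2

theorem lp_two_hasSum (c : lp (fun _ : ι => 𝕜) 2) : HasSum (fun i => ‖c i‖ ^ 2) (‖c‖ ^ 2) := by
  simpa using lp.hasSum_norm (p := 2) (by norm_num) c

/-! ### The synthesis operator -/

/-- The synthesis operator of a Bessel family maps `c` to `∑ c i • x i`; it is the adjoint of the
analysis operator `v ↦ (⟨v, x i⟩)`, whose boundedness is the Bessel condition. -/
theorem IsBessel.exists_synthesis [CompleteSpace H] {x : ι → H} (hx : IsBessel 𝕜 x) :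
    ∃ T : lp (fun _ : ι => 𝕜) 2 →L[𝕜] H, (∀ c, HasSum (fun i => c i • x i) (T c)) ∧
      ∀ v i, ContinuousLinearMap.adjoint T v i = inner 𝕜 (x i) v := by
  classical
  obtain ⟨B, hB⟩ := hx
  let C₀ : H →ₗ[𝕜] lp (fun _ : ι => 𝕜) 2 :=
    { toFun := fun v => ⟨fun i => inner 𝕜 (x i) v, memℓp_two_iff.2 (hB v).1⟩
      map_add' := fun v w => by
        ext i
        exact inner_add_right _ _ _
      map_smul' := fun a v => by
        ext i
        exact inner_smul_right _ _ _ }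
  have hC₀ : ∀ v i, C₀ v i = inner 𝕜 (x i) v := fun v i => rfl
  let C : H →L[𝕜] lp (fun _ : ι => 𝕜) 2 := C₀.mkContinuous (Real.sqrt B) fun v => by
    have h1 : ‖C₀ v‖ ^ 2 ≤ B * ‖v‖ ^ 2 := by
      rw [← (lp_two_hasSum (C₀ v)).tsum_eq]
      exact (hB v).2
    calc ‖C₀ v‖ = Real.sqrt (‖C₀ v‖ ^ 2) := (Real.sqrt_sq (norm_nonneg _)).symm
      _ ≤ Real.sqrt (B * ‖v‖ ^ 2) := Real.sqrt_le_sqrt h1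
      _ = Real.sqrt B * ‖v‖ := by
        rw [Real.sqrt_mul' _ (by positivity), Real.sqrt_sq (norm_nonneg _)]
  have hC : ∀ v i, C v i = inner 𝕜 (x i) v := fun v i => rfl
  refine ⟨ContinuousLinearMap.adjoint C, fun c => ?_, fun v i => ?_⟩
  · have h1 := (ContinuousLinearMap.adjoint C).hasSum (lp.hasSum_single (by norm_num) c)
    convert h1 using 2 with i
    refine ext_inner_right 𝕜 fun v => ?_
    rw [ContinuousLinearMap.adjoint_inner_left, lp.inner_single_left, hC, inner_smul_left]
    simp [mul_comm]
  · rw [ContinuousLinearMap.adjoint_adjoint, hC]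

theorem synthesis_single [DecidableEq ι] {x : ι → H} {T : lp (fun _ : ι => 𝕜) 2 →L[𝕜] H}
    (hT : ∀ c, HasSum (fun i => c i • x i) (T c)) (i : ι) (a : 𝕜) :
    T (lp.single 2 i a) = a • x i := by
  refine (hT _).unique ?_
  convert hasSum_single i ?_ using 1
  · simp
  · intro j hj
    simp [hj]

theorem norm_sum_smul_le {x : ι → H} {T : lp (fun _ : ι => 𝕜) 2 →L[𝕜] H}
    (hT : ∀ c, HasSum (fun i => c i • x i) (T c)) (c : lp (fun _ : ι => 𝕜) 2) (s : Finset ι) :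
    ‖∑ i ∈ s, c i • x i‖ ≤ ‖T‖ * ‖c‖ := by
  classical
  have h1 : ∑ i ∈ s, c i • x i = T (∑ i ∈ s, lp.single 2 i (c i)) := by
    rw [map_sum]
    exact Finset.sum_congr rfl fun i _ => (synthesis_single hT i _).symm
  rw [h1]
  refine (T.le_opNorm _).trans (mul_le_mul_of_nonneg_left ?_ (norm_nonneg _))
  have h2 := lp.norm_sum_single (p := 2) (E := fun _ : ι => 𝕜) (by norm_num) (fun i => c i) s
  have h3 := lp.sum_rpow_le_norm_rpow (p := 2) (by norm_num) c s
  rw [← h2] at h3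
  simp only [ENNReal.toReal_ofNat, Real.rpow_ofNat] at h3
  exact (sq_le_sq₀ (norm_nonneg _) (norm_nonneg _)).1 h3

/-- The lower frame bound makes the frame operator `T ∘ T*` coercive, hence invertible; the adjoint
of its inverse carries a frame to its canonical dual. -/
theorem IsFrame.exists_dual [CompleteSpace H] {x : ℕ → H} (hx : IsFrame 𝕜 x) :
    ∃ y : ℕ → H, (∀ v, Summable fun n => ‖inner 𝕜 (y n) v‖ ^ 2) ∧
      ∀ v, HasSum (fun n => inner 𝕜 (y n) v • x n) v := by
  obtain ⟨T, hT, hT'⟩ := hx.isBessel.exists_synthesis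
  obtain ⟨A, B, hA, -, h⟩ := hx
  have hu : IsUnit (T ∘L ContinuousLinearMap.adjoint T) := by
    refine ContinuousLinearMap.isUnit_of_forall_le_norm_inner_map _ (c := ⟨A, hA.le⟩) hA fun v => ?_
    rw [ContinuousLinearMap.comp_apply, ← ContinuousLinearMap.adjoint_inner_right,
      inner_self_eq_norm_sq_to_K]
    have h1 := lp_two_hasSum (ContinuousLinearMap.adjoint T v)
    simp only [hT'] at h1
    have h2 := (h v).2.1
    rw [h1.tsum_eq] at h2
    rw [mul_comm] at h2
    refine h2.trans_eq ?_
    simp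
  obtain ⟨R, hR⟩ := hu.exists_right_inv
  have key : ∀ v n, inner 𝕜 (ContinuousLinearMap.adjoint R (x n)) v
      = ContinuousLinearMap.adjoint T (R v) n := fun v n => by
    rw [ContinuousLinearMap.adjoint_inner_left, hT']
  refine ⟨fun n => ContinuousLinearMap.adjoint R (x n), fun v => ?_, fun v => ?_⟩
  · simp only [key]
    exact lp_two_summable _
  · simp only [key]
    convert hT _ using 1
    exact (DFunLike.congr_fun hR v).symm

/-! ### Convergent expansions with coefficients outside `ℓ²` -/

/-- If the kernel of the synthesis operator is infinite-dimensional, it contains nonzero elements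
vanishing on any initial segment; truncations of these are blocks of prescribed norm with
arbitrarily small synthesis. -/
theorem exists_block {x : ℕ → H} {T : lp (fun _ : ℕ => 𝕜) 2 →L[𝕜] H}
    (hT : ∀ c, HasSum (fun n => c n • x n) (T c))
    (hker : ¬ FiniteDimensional 𝕜 (LinearMap.ker (T : lp (fun _ : ℕ => 𝕜) 2 →ₗ[𝕜] H)))
    (N : ℕ) {δ ε : ℝ} (hδ : 0 < δ) (hε : 0 < ε) :
    ∃ M > N, ∃ b : ℕ → 𝕜, δ ^ 2 ≤ 2 * ∑ n ∈ Finset.Ico N M, ‖b n‖ ^ 2 ∧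
      ‖∑ n ∈ Finset.Ico N M, b n • x n‖ ≤ ε ∧
      ∀ m, ‖∑ n ∈ Finset.Ico N m, b n • x n‖ ≤ ‖T‖ * δ := by
  let K := LinearMap.ker (T : lp (fun _ : ℕ => 𝕜) 2 →ₗ[𝕜] H)
  let φ : K →ₗ[𝕜] (Fin N → 𝕜) :=
    { toFun := fun c i => (c : lp (fun _ : ℕ => 𝕜) 2) i
      map_add' := fun c d => by
        ext i
        simp
      map_smul' := fun a c => by
        ext i
        simp }
  obtain ⟨k, hk0, hTk, hkN⟩ : ∃ k : lp (fun _ : ℕ => 𝕜) 2, k ≠ 0 ∧ T k = 0 ∧ ∀ n < N, k n = 0 := by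
    by_contra! hcon
    refine hker (FiniteDimensional.of_injective φ ?_)
    rw [injective_iff_map_eq_zero]
    intro c hc
    by_contra hne
    obtain ⟨n, hn, hn'⟩ := hcon c (fun h => hne (Subtype.ext h)) c.2
    exact hn' (congrFun hc ⟨n, hn⟩)
  let b : lp (fun _ : ℕ => 𝕜) 2 := ((δ / ‖k‖ : ℝ) : 𝕜) • k
  have hkpos : 0 < ‖k‖ := norm_pos_iff.2 hk0
  have hbn : ‖b‖ = δ := by
    have : ‖b‖ = |δ / ‖k‖| * ‖k‖ := by rw [norm_smul, RCLike.norm_ofReal]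
    rw [this, abs_of_pos (by positivity)]
    field_simp
  have hTb : T b = 0 := by rw [map_smul, hTk, smul_zero]
  have hbN : ∀ n < N, b n = 0 := fun n hn => by
    have : b n = ((δ / ‖k‖ : ℝ) : 𝕜) * k n := rfl
    rw [this, hkN n hn, mul_zero]
  have hIco : ∀ m, ∑ n ∈ Finset.Ico N m, b n • x n = ∑ n ∈ Finset.range m, b n • x n := fun m => by
    refine Finset.sum_subset (fun n hn => ?_) fun n hn hn' => ?_
    · simp only [Finset.mem_Ico, Finset.mem_range] at *
      exact hn.2
    · simp only [Finset.mem_Ico, Finset.mem_range, not_and, not_lt] at *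
      rw [hbN n (by by_contra! h; have := hn' h; omega), zero_smul]
  have hIco' : ∀ m, ∑ n ∈ Finset.Ico N m, ‖b n‖ ^ 2 = ∑ n ∈ Finset.range m, ‖b n‖ ^ 2 := fun m => by
    refine Finset.sum_subset (fun n hn => ?_) fun n hn hn' => ?_
    · simp only [Finset.mem_Ico, Finset.mem_range] at *
      exact hn.2
    · simp only [Finset.mem_Ico, Finset.mem_range, not_and, not_lt] at *
      rw [hbN n (by by_contra! h; have := hn' h; omega)]
      simp
  have h1 : ∀ᶠ m in atTop, δ ^ 2 / 2 < ∑ n ∈ Finset.range m, ‖b n‖ ^ 2 := by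
    have := (lp_two_hasSum b).tendsto_sum_nat
    rw [hbn] at this
    exact this.eventually_const_lt (half_lt_self (by positivity))
  have h2 : ∀ᶠ m in atTop, ‖∑ n ∈ Finset.range m, b n • x n‖ < ε := by
    have := (hT b).tendsto_sum_nat.norm
    rw [hTb, norm_zero] at this
    exact this.eventually_lt_const hε
  obtain ⟨M, h1, h2, h3⟩ := (h1.and (h2.and (eventually_gt_atTop N))).exists
  refine ⟨M, h3, fun n => b n, ?_, ?_, fun m => ?_⟩
  · rw [hIco']
    linarith
  · rw [hIco]
    exact h2.le
  · rw [← hbn]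
    exact norm_sum_smul_le hT b _

/-- Concatenating blocks of norm about `1 / √(j + 1)` and synthesis at most `2⁻ʲ` gives a sequence
outside `ℓ²` whose expansion converges: the partial sums inside a block are small because the
block is, and the sums at the ends of the blocks form a Cauchy sequence. -/
theorem exists_tendsto_not_summable [CompleteSpace H] {x : ℕ → H} {C : ℝ}
    (h : ∀ N : ℕ, ∀ δ > 0, ∀ ε > 0, ∃ M > N, ∃ b : ℕ → 𝕜,
      δ ^ 2 ≤ 2 * ∑ n ∈ Finset.Ico N M, ‖b n‖ ^ 2 ∧
      ‖∑ n ∈ Finset.Ico N M, b n • x n‖ ≤ ε ∧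
      ∀ m, ‖∑ n ∈ Finset.Ico N m, b n • x n‖ ≤ C * δ) :
    ∃ (c : ℕ → 𝕜) (L : H), Tendsto (fun N => ∑ n ∈ Finset.range N, c n • x n) atTop (𝓝 L) ∧
      ¬ Summable (fun n => ‖c n‖ ^ 2) := by
  let δ : ℕ → ℝ := fun j => Real.sqrt (1 / ((j : ℝ) + 1))
  have hδ : ∀ j, 0 < δ j := fun j => Real.sqrt_pos.2 (by positivity)
  have hδ2 : ∀ j, δ j ^ 2 = 1 / ((j : ℝ) + 1) := fun j => Real.sq_sqrt (by positivity)
  have hδ0 : Tendsto δ atTop (𝓝 0) := by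
    have := (Real.continuous_sqrt.tendsto 0).comp
      (tendsto_one_div_add_atTop_nhds_zero_nat (𝕜 := ℝ))
    rwa [Real.sqrt_zero] at this
  choose M hM b hb1 hb2 hb3 using fun N (j : ℕ) =>
    h N (δ j) (hδ j) (1 * (1 / 2 : ℝ) ^ j) (by positivity)
  -- the `j`-th block occupies the indices from `P j` to `P (j + 1) - 1`
  let P : ℕ → ℕ := fun j => Nat.rec (motive := fun _ => ℕ) 0 (fun j N => M N j) j
  have hP0 : P 0 = 0 := rfl
  have hPs : ∀ j, P (j + 1) = M (P j) j := fun j => rfl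
  have hPmono : StrictMono P := strictMono_nat_of_lt_succ fun j => hM (P j) j
  -- `J n` is the number of the block that contains the index `n`
  let J : ℕ → ℕ := fun n => Nat.findGreatest (fun j => P j ≤ n) n
  have hJ1 : ∀ n, P (J n) ≤ n := fun n => by
    have h0 : P 0 ≤ n := Nat.zero_le n
    exact Nat.findGreatest_spec (P := fun j => P j ≤ n) (Nat.zero_le n) h0
  have hJ2 : ∀ n j, P j ≤ n → j ≤ J n := fun n j hj =>
    Nat.le_findGreatest (P := fun j => P j ≤ n) ((hPmono.id_le j).trans hj) hj
  have hJ : ∀ n j, P j ≤ n → n < P (j + 1) → J n = j := fun n j h1 h2 => by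
    refine le_antisymm ?_ (hJ2 n j h1)
    by_contra! h3
    exact absurd ((hPmono.monotone h3).trans (hJ1 n)) (not_le.2 h2)
  have hJlt : ∀ n, n < P (J n + 1) := fun n => by
    by_contra! h3
    have := hJ2 n (J n + 1) h3
    omega
  have hJtop : Tendsto J atTop atTop :=
    tendsto_atTop.2 fun j => (eventually_ge_atTop (P j)).mono fun n hn => hJ2 n j hn
  let c : ℕ → 𝕜 := fun n => b (P (J n)) (J n) n
  have hc : ∀ j n, P j ≤ n → n < P (j + 1) → c n = b (P j) j n := fun j n h1 h2 => by
    change b (P (J n)) (J n) n = _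
    rw [hJ n j h1 h2]
  let s : ℕ → H := fun N => ∑ n ∈ Finset.range N, c n • x n
  have hs : ∀ j m, P j ≤ m → m ≤ P (j + 1) →
      s m = s (P j) + ∑ n ∈ Finset.Ico (P j) m, b (P j) j n • x n := fun j m h1 h2 => by
    change ∑ n ∈ Finset.range m, c n • x n = ∑ n ∈ Finset.range (P j), c n • x n + _
    rw [← Finset.sum_range_add_sum_Ico _ h1]
    congr 1
    refine Finset.sum_congr rfl fun n hn => ?_
    rw [Finset.mem_Ico] at hn
    rw [hc j n hn.1 (by omega)]
  have hcau : CauchySeq (fun j => s (P j)) := by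
    refine cauchySeq_of_le_geometric (1 / 2) 1 (by norm_num) fun j => ?_
    rw [hs j (P (j + 1)) (hPmono.monotone (Nat.le_succ j)) le_rfl, dist_self_add_right]
    exact hb2 (P j) j
  obtain ⟨L, hL⟩ := cauchySeq_tendsto_of_complete hcau
  refine ⟨c, L, ?_, fun hsum => ?_⟩
  · have h1 : Tendsto (fun m => s m - s (P (J m))) atTop (𝓝 0) := by
      have h2 : Tendsto (fun m => C * δ (J m)) atTop (𝓝 0) := by
        simpa using (hδ0.comp hJtop).const_mul C
      refine squeeze_zero_norm (fun m => ?_) h2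
      rw [hs (J m) m (hJ1 m) (hJlt m).le, add_sub_cancel_left]
      exact hb3 _ _ _
    simpa using h1.add (hL.comp hJtop)
  · -- up to a factor `2`, the norms of the blocks dominate the harmonic series
    have hle : ∀ j, ∑ i ∈ Finset.range j, 1 / ((i : ℝ) + 1)
        ≤ 2 * ∑ n ∈ Finset.range (P j), ‖c n‖ ^ 2 := by
      intro j
      induction j with
      | zero => simp [hP0]
      | succ j ih =>
        rw [Finset.sum_range_succ,
          ← Finset.sum_range_add_sum_Ico _ (hPmono.monotone (Nat.le_succ j)), mul_add]
        refine add_le_add ih ?_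
        rw [← hδ2]
        refine (hb1 (P j) j).trans_eq ?_
        rw [← hPs]
        congr 1
        refine Finset.sum_congr rfl fun n hn => ?_
        rw [Finset.mem_Ico] at hn
        rw [hc j n hn.1 hn.2]
    refine Real.not_summable_one_div_natCast ((summable_nat_add_iff 1).1 ?_)
    refine summable_of_sum_range_le (c := 2 * ∑' n, ‖c n‖ ^ 2) (fun n => by positivity) fun j => ?_
    push_cast
    exact (hle j).trans (mul_le_mul_of_nonneg_left
      (hsum.sum_le_tsum _ fun n _ => by positivity) (by norm_num))

/-- Given a convergent expansion with coefficients outside `ℓ²`, one may subtract the canonical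
coefficients of its sum and obtain an expansion `d` of `0`; adding the rank-one term
`conj (d n) • u` to the canonical dual then gives another dual, whose coefficients of `u` are not
square-summable. -/
theorem IsFrame.not_extendedMomentSpace_subset [CompleteSpace H] [Nontrivial H] {x : ℕ → H}
    (hx : IsFrame 𝕜 x) {c : ℕ → 𝕜} {L : H}
    (hc : Tendsto (fun N => ∑ n ∈ Finset.range N, c n • x n) atTop (𝓝 L))
    (hc' : ¬ Summable (fun n => ‖c n‖ ^ 2)) :
    ¬ extendedMomentSpace 𝕜 x ⊆ squareSummable 𝕜 := by
  intro hsub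
  obtain ⟨y, hy, hy'⟩ := hx.exists_dual
  obtain ⟨w, hw⟩ := exists_ne (0 : H)
  let u : H := ((‖w‖⁻¹ : ℝ) : 𝕜) • w
  have hu : inner 𝕜 u u = 1 := by
    have : ‖u‖ = 1 := by
      rw [norm_smul, RCLike.norm_ofReal, abs_of_nonneg (by positivity),
        inv_mul_cancel₀ (norm_ne_zero_iff.2 hw)]
    rw [inner_self_eq_norm_sq_to_K, this]
    simp
  let d : ℕ → 𝕜 := fun n => c n - inner 𝕜 (y n) L
  have hd : Tendsto (fun N => ∑ n ∈ Finset.range N, d n • x n) atTop (𝓝 0) := by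
    have := hc.sub (hy' L).tendsto_sum_nat
    simpa only [d, sub_smul, Finset.sum_sub_distrib, sub_self] using this
  let z : ℕ → H := fun n => y n + (starRingEnd 𝕜 (d n)) • u
  have hz : ∀ n v, inner 𝕜 (z n) v = inner 𝕜 (y n) v + inner 𝕜 u v * d n := fun n v => by
    simp [z, inner_add_left, inner_smul_left, mul_comm]
  have hdual : IsAlternativeDual 𝕜 x z := fun v => by
    have := (hy' v).tendsto_sum_nat.add (hd.const_smul (inner 𝕜 u v))
    simpa only [hz, add_smul, mul_smul, Finset.sum_add_distrib, Finset.smul_sum, smul_zero,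
      add_zero] using this
  have hmem : (fun n => inner 𝕜 (z n) u) ∈ squareSummable 𝕜 :=
    hsub (Set.mem_biUnion (x := z) hdual ⟨u, rfl⟩)
  have h1 : Memℓp (fun n => inner 𝕜 (z n) u) 2 := memℓp_two_iff.2 hmem
  have h2 := (h1.sub (memℓp_two_iff.2 (hy u))).add (memℓp_two_iff.2 (hy L))
  refine hc' ((memℓp_two_iff.1 h2).congr fun n => ?_)
  simp only [hz, hu, d, Pi.add_apply, Pi.sub_apply]
  congr 2
  ring

/-! ### Riesz bases from bijective synthesis operators -/

/-- An infinite-dimensional separable Hilbert space has a Hilbert basis indexed by any countably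
infinite type. -/
theorem nonempty_hilbertBasis [CompleteSpace H] [TopologicalSpace.SeparableSpace H]
    (hH : ¬ FiniteDimensional 𝕜 H) [Countable ι] [Infinite ι] :
    Nonempty (HilbertBasis ι 𝕜 H) := by
  obtain ⟨w, b, hb⟩ := exists_hilbertBasis 𝕜 H
  have hinf : Infinite w := by
    by_contra hfin
    rw [not_infinite_iff_finite] at hfin
    have := Fintype.ofFinite w
    exact hH b.toOrthonormalBasis.toBasis.finiteDimensional_of_finite
  have : SecondCountableTopology H := UniformSpace.secondCountable_of_separable H
  have : DiscreteTopology w := by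
    -- distinct unit vectors of an orthonormal family are at distance `√2 ≥ 1`
    refine DiscreteTopology.of_forall_le_dist one_pos fun i j hij => ?_
    have h1 : inner 𝕜 (i : H) (j : H) = 0 := by
      have := b.orthonormal.2 hij
      rwa [hb] at this
    have h2 : ‖(i : H)‖ = 1 := by
      have := b.orthonormal.1 i
      rwa [hb] at this
    have h3 : ‖(j : H)‖ = 1 := by
      have := b.orthonormal.1 j
      rwa [hb] at this
    have h4 := norm_sub_sq (𝕜 := 𝕜) (i : H) (j : H)
    rw [h1, h2, h3] at h4
    change 1 ≤ dist (i : H) (j : H)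
    rw [dist_eq_norm]
    simp only [map_zero] at h4
    nlinarith [norm_nonneg ((i : H) - j)]
  have : Countable w := countable_of_Lindelof_of_discrete
  obtain ⟨f⟩ : Nonempty (ι ≃ w) := nonempty_equiv_of_countable
  refine ⟨HilbertBasis.mk (v := b ∘ f) (b.orthonormal.comp f f.injective) ?_⟩
  rw [f.surjective.range_comp, b.dense_span]

theorem isRieszBasis_of_synthesis_bijective [CompleteSpace H] [TopologicalSpace.SeparableSpace H]
    (hH : ¬ FiniteDimensional 𝕜 H) [Countable ι] [Infinite ι] {x : ι → H}
    {T : lp (fun _ : ι => 𝕜) 2 →L[𝕜] H} (hT : ∀ c, HasSum (fun i => c i • x i) (T c))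
    (hbij : Function.Bijective T) : IsRieszBasis 𝕜 x := by
  classical
  obtain ⟨e⟩ := nonempty_hilbertBasis (ι := ι) hH
  refine ⟨e, T ∘L (e.repr.toContinuousLinearEquiv : H →L[𝕜] lp (fun _ : ι => 𝕜) 2),
    hbij.comp e.repr.bijective, fun i => ?_⟩
  change x i = T (e.repr (e i))
  rw [e.repr_self, synthesis_single hT, one_smul]

/-! ### Removing finitely many vectors -/

/-- A surjective operator on `ℓ²(ℕ)` with finite-dimensional kernel becomes bijective when
restricted to the sequences vanishing on a suitable finite set of indices. As long as some nonzero
`c` in the kernel vanishes on the current set, an index where `c` does not vanish can be added: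
the operator stays surjective and the dimension of the kernel drops. -/
theorem exists_finset_bijective {T : lp (fun _ : ℕ => 𝕜) 2 →L[𝕜] H}
    (hsurj : Function.Surjective T)
    (hker : FiniteDimensional 𝕜 (LinearMap.ker (T : lp (fun _ : ℕ => 𝕜) 2 →ₗ[𝕜] H))) :
    ∃ F : Finset ℕ, (∀ v, ∃ c, (∀ n ∈ F, c n = 0) ∧ T c = v) ∧
      ∀ c, (∀ n ∈ F, c n = 0) → T c = 0 → c = 0 := by
  classical
  let K : Finset ℕ → Submodule 𝕜 (lp (fun _ : ℕ => 𝕜) 2) := fun F =>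
    { carrier := {c | T c = 0 ∧ ∀ n ∈ F, c n = 0}
      add_mem' := fun {a b} ha hb => ⟨by rw [map_add, ha.1, hb.1, add_zero], fun n hn => by
        rw [lp.coeFn_add, Pi.add_apply, ha.2 n hn, hb.2 n hn, add_zero]⟩
      zero_mem' := ⟨map_zero T, fun n _ => rfl⟩
      smul_mem' := fun a c hc => ⟨by rw [map_smul, hc.1, smul_zero], fun n hn => by
        rw [lp.coeFn_smul, Pi.smul_apply, hc.2 n hn, smul_zero]⟩ }
  have hK : ∀ F c, c ∈ K F ↔ T c = 0 ∧ ∀ n ∈ F, c n = 0 := fun F c => Iff.rfl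
  have hfin : ∀ F, FiniteDimensional 𝕜 (K F) := fun F =>
    Submodule.finiteDimensional_of_le (S₂ := LinearMap.ker (T : lp (fun _ : ℕ => 𝕜) 2 →ₗ[𝕜] H))
      fun c hc => hc.1
  suffices h : ∀ (d : ℕ) (F : Finset ℕ), Module.finrank 𝕜 (K F) = d →
      (∀ v, ∃ c, (∀ n ∈ F, c n = 0) ∧ T c = v) →
      ∃ F : Finset ℕ, (∀ v, ∃ c, (∀ n ∈ F, c n = 0) ∧ T c = v) ∧
        ∀ c, (∀ n ∈ F, c n = 0) → T c = 0 → c = 0 by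
    refine h _ ∅ rfl fun v => ?_
    obtain ⟨c, hc⟩ := hsurj v
    exact ⟨c, by simp, hc⟩
  intro d
  induction d using Nat.strong_induction_on with
  | _ d ih =>
    intro F hd hF
    by_cases hinj : ∀ c, (∀ n ∈ F, c n = 0) → T c = 0 → c = 0
    · exact ⟨F, hF, hinj⟩
    push Not at hinj
    obtain ⟨k, hkF, hTk, hk0⟩ := hinj
    obtain ⟨m, hm⟩ : ∃ m, k m ≠ 0 := by
      by_contra! h
      exact hk0 (lp.ext (funext h))
    refine ih _ ?_ (insert m F) rfl fun v => ?_
    · rw [← hd]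
      have := hfin F
      refine Submodule.finrank_lt_finrank_of_lt (lt_of_le_of_ne ?_ fun heq => ?_)
      · exact fun c hc => ⟨hc.1, fun n hn => hc.2 n (Finset.mem_insert_of_mem hn)⟩
      · have h1 : k ∈ K F := ⟨hTk, hkF⟩
        rw [← heq] at h1
        exact hm (h1.2 m (Finset.mem_insert_self m F))
    · obtain ⟨c, hc, hTc⟩ := hF v
      refine ⟨c - (c m / k m) • k, fun n hn => ?_, by rw [map_sub, map_smul, hTk, hTc]; simp⟩
      have h1 : (c - (c m / k m) • k) n = c n - c m / k m * k n := rfl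
      rw [h1]
      rcases Finset.mem_insert.1 hn with rfl | hn
      · field_simp
        simp
      · rw [hc n hn, hkF n hn]
        simp

theorem IsFrame.isNearRieszBasis [CompleteSpace H] [TopologicalSpace.SeparableSpace H]
    (hH : ¬ FiniteDimensional 𝕜 H) {x : ℕ → H} (hx : IsFrame 𝕜 x)
    {T : lp (fun _ : ℕ => 𝕜) 2 →L[𝕜] H} (hT : ∀ c, HasSum (fun n => c n • x n) (T c))
    (hsurj : Function.Surjective T)
    (hker : FiniteDimensional 𝕜 (LinearMap.ker (T : lp (fun _ : ℕ => 𝕜) 2 →ₗ[𝕜] H))) :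
    IsNearRieszBasis 𝕜 x := by
  obtain ⟨F, hF, hF'⟩ := exists_finset_bijective hsurj hker
  refine ⟨F, ?_⟩
  have : Infinite {n : ℕ // n ∉ F} := F.finite_toSet.infinite_compl.to_subtype
  obtain ⟨TF, hTF, -⟩ := (hx.isBessel.subtype (· ∉ F)).exists_synthesis
  have hinj : Function.Injective (Subtype.val : {n : ℕ // n ∉ F} → ℕ) := Subtype.val_injective
  -- sequences vanishing on `F` correspond to sequences indexed by the complement of `F`
  have key : ∀ (c : lp (fun _ : ℕ => 𝕜) 2) (d : lp (fun _ : {n : ℕ // n ∉ F} => 𝕜) 2),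
      (∀ n ∈ F, c n = 0) → (∀ i, d i = c i) → TF d = T c := fun c d hc hd => by
    refine (hTF d).unique ?_
    simp only [hd]
    refine (hinj.hasSum_iff (f := fun n => c n • x n) fun n hn => ?_).2 (hT c)
    have hn' : n ∈ F := by
      by_contra h
      exact hn ⟨⟨n, h⟩, rfl⟩
    rw [hc n hn', zero_smul]
  refine isRieszBasis_of_synthesis_bijective hH hTF ⟨?_, fun v => ?_⟩
  · rw [injective_iff_map_eq_zero]
    intro d hd
    have hext : ∀ i : {n : ℕ // n ∉ F}, Function.extend Subtype.val (fun i => d i) 0 (i : ℕ) = d i :=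
      fun i => hinj.extend_apply _ _ i
    have hext0 : ∀ n, n ∈ F → Function.extend Subtype.val (fun i => d i) (0 : ℕ → 𝕜) n = 0 :=
      fun n hn => Function.extend_apply' _ _ _ fun ⟨i, hi⟩ => i.2 (hi ▸ hn)
    let c : lp (fun _ : ℕ => 𝕜) 2 := ⟨Function.extend Subtype.val (fun i => d i) 0, by
      refine memℓp_two_iff.2 ?_
      rw [← F.summable_compl_iff]
      refine (lp_two_summable d).congr fun i => ?_
      rw [hext]⟩
    have hc0 : c = 0 := hF' c hext0 (by rw [← key c d hext0 fun i => (hext i).symm, hd])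
    ext i
    rw [← hext i]
    exact congrFun (congrArg (fun c : lp (fun _ : ℕ => 𝕜) 2 => (c : ℕ → 𝕜)) hc0) i
  · obtain ⟨c, hc, hTc⟩ := hF v
    let d : lp (fun _ : {n : ℕ // n ∉ F} => 𝕜) 2 :=
      ⟨fun i => c i, memℓp_two_iff.2 ((lp_two_summable c).subtype {n | n ∉ F})⟩
    exact ⟨d, by rw [key c d hc fun i => rfl, hTc]⟩

/-! ### Expansions in Riesz bases and near-Riesz bases -/

/-- The coefficients of a convergent expansion in a near-Riesz basis are square-summable: up to
finitely many terms, inverting the operator that defines the Riesz basis turns the expansion into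
one in an orthonormal basis. -/
theorem IsNearRieszBasis.summable_of_tendsto [CompleteSpace H] {x : ℕ → H}
    (hx : IsNearRieszBasis 𝕜 x) {c : ℕ → 𝕜} {v : H}
    (hc : Tendsto (fun N => ∑ n ∈ Finset.range N, c n • x n) atTop (𝓝 v)) :
    Summable (fun n => ‖c n‖ ^ 2) := by
  classical
  obtain ⟨F, e, T, hT, hxe⟩ := hx
  let Φ : H ≃L[𝕜] H := ContinuousLinearEquiv.ofBijective T
    (LinearMap.ker_eq_bot.2 hT.1) (LinearMap.range_eq_top.2 hT.2)
  have hΦ : ∀ i : {n : ℕ // n ∉ F}, Φ.symm (x i) = e i := fun i => by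
    rw [ContinuousLinearEquiv.symm_apply_eq]
    exact hxe i
  have key : ∀ i : {n : ℕ // n ∉ F},
      inner 𝕜 (e i) (Φ.symm v - ∑ n ∈ F, c n • Φ.symm (x n)) = c i := fun i => by
    let f : ℕ → 𝕜 := fun n => c n * inner 𝕜 (e i) (Φ.symm (x n))
    have h1 : Tendsto (fun N => ∑ n ∈ Finset.range N, f n) atTop (𝓝 (inner 𝕜 (e i) (Φ.symm v))) := by
      have h2 : Continuous fun w => inner 𝕜 (e i) (Φ.symm w) :=
        continuous_const.inner Φ.symm.continuous
      have h3 := (h2.tendsto v).comp hc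
      convert h3 using 2 with N
      simp [f, inner_sum, inner_smul_right]
    have h2 : HasSum f (∑ n ∈ insert (i : ℕ) F, f n) := by
      refine hasSum_sum_of_ne_finset_zero fun n hn => ?_
      rw [Finset.mem_insert, not_or] at hn
      have h3 := e.orthonormal.2 (i := i) (j := ⟨n, hn.2⟩) fun h => hn.1 (congrArg Subtype.val h).symm
      change c n * inner 𝕜 (e i) (Φ.symm (x n)) = 0
      rw [hΦ ⟨n, hn.2⟩, h3, mul_zero]
    have h4 := tendsto_nhds_unique h1 h2.tendsto_sum_nat
    rw [Finset.sum_insert i.2] at h4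
    have h5 : f i = c i := by
      change c i * inner 𝕜 (e i) (Φ.symm (x i)) = c i
      rw [hΦ, inner_self_eq_norm_sq_to_K, e.orthonormal.1 i]
      simp
    rw [inner_sub_right, h4, h5, inner_sum]
    simp [f, inner_smul_right]
  rw [← F.summable_compl_iff]
  refine (e.orthonormal.inner_products_summable
    (Φ.symm v - ∑ n ∈ F, c n • Φ.symm (x n))).congr fun i => ?_
  rw [key]

theorem IsNearRieszBasis.extendedMomentSpace_subset [CompleteSpace H] {x : ℕ → H}
    (hx : IsNearRieszBasis 𝕜 x) : extendedMomentSpace 𝕜 x ⊆ squareSummable 𝕜 := by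
  rintro c hc
  simp only [extendedMomentSpace, Set.mem_iUnion] at hc
  obtain ⟨y, hy, v, rfl⟩ := hc
  exact hx.summable_of_tendsto (hy v)

theorem IsRieszBasis.isNearRieszBasis [CompleteSpace H] {x : ℕ → H} (hx : IsRieszBasis 𝕜 x) :
    IsNearRieszBasis 𝕜 x := by
  obtain ⟨e, T, hT, hxe⟩ := hx
  refine ⟨∅, ?_⟩
  let f : {n : ℕ // n ∉ (∅ : Finset ℕ)} ≃ ℕ := Equiv.subtypeUnivEquiv fun n => Finset.notMem_empty n
  refine ⟨HilbertBasis.mk (v := e ∘ f) (e.orthonormal.comp f f.injective) ?_, T, hT, fun i => ?_⟩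
  · rw [f.surjective.range_comp, e.dense_span]
  · rw [HilbertBasis.coe_mk]
    exact hxe i

/-- The dual of the Riesz basis `T (e n)` given by `(T⁻¹)* (e n)` has moment space `ℓ²`. -/
theorem IsRieszBasis.squareSummable_subset [CompleteSpace H] {x : ℕ → H}
    (hx : IsRieszBasis 𝕜 x) : squareSummable 𝕜 ⊆ extendedMomentSpace 𝕜 x := by
  obtain ⟨e, T, hT, hxe⟩ := hx
  intro c hc
  let Φ : H ≃L[𝕜] H := ContinuousLinearEquiv.ofBijective T
    (LinearMap.ker_eq_bot.2 hT.1) (LinearMap.range_eq_top.2 hT.2)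
  let y : ℕ → H := fun n => ContinuousLinearMap.adjoint (Φ.symm : H →L[𝕜] H) (e n)
  have hy : ∀ n v, inner 𝕜 (y n) v = e.repr (Φ.symm v) n := fun n v => by
    rw [ContinuousLinearMap.adjoint_inner_left, e.repr_apply_apply]
    rfl
  have hdual : IsAlternativeDual 𝕜 x y := fun v => by
    have h1 := (T.hasSum (e.hasSum_repr (Φ.symm v))).tendsto_sum_nat
    have h2 : T (Φ.symm v) = v := Φ.apply_symm_apply v
    rw [h2] at h1
    simpa only [hy, hxe, map_smul] using h1
  refine Set.mem_biUnion (x := y) hdual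
    ⟨Φ (e.repr.symm ⟨c, memℓp_two_iff.2 hc⟩), funext fun n => ?_⟩
  rw [hy, Φ.symm_apply_apply, LinearIsometryEquiv.apply_symm_apply]

end

theorem theorem3p15 {𝕜 : Type*} [RCLike 𝕜] {H : Type*} [NormedAddCommGroup H]
    [InnerProductSpace 𝕜 H] [CompleteSpace H] [TopologicalSpace.SeparableSpace H]
    (hH : ¬ FiniteDimensional 𝕜 H) (x : ℕ → H) (hx : IsFrame 𝕜 x) :
    (extendedMomentSpace 𝕜 x ⊆ squareSummable 𝕜 ↔ IsNearRieszBasis 𝕜 x) ∧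
    (extendedMomentSpace 𝕜 x = squareSummable 𝕜 ↔ IsRieszBasis 𝕜 x) := by
  obtain ⟨T, hT, -⟩ := hx.isBessel.exists_synthesis
  have hsurj : Function.Surjective T := fun v => by
    obtain ⟨y, hy, hy'⟩ := hx.exists_dual
    exact ⟨⟨fun n => inner 𝕜 (y n) v, memℓp_two_iff.2 (hy v)⟩, (hT _).unique (hy' v)⟩
  have : Nontrivial H := by
    by_contra h
    rw [not_nontrivial_iff_subsingleton] at h
    exact hH inferInstance
  refine ⟨⟨fun h => ?_, fun h => h.extendedMomentSpace_subset⟩,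
    ⟨fun h => ?_, fun h => Set.Subset.antisymm h.isNearRieszBasis.extendedMomentSpace_subset
      h.squareSummable_subset⟩⟩
  · by_contra hcon
    obtain ⟨c, L, hc, hc'⟩ := exists_tendsto_not_summable (𝕜 := 𝕜) (x := x) (C := ‖T‖)
      fun N δ hδ ε hε => exists_block hT
        (fun hker => hcon (hx.isNearRieszBasis hH hT hsurj hker)) N hδ hε
    exact hx.not_extendedMomentSpace_subset hc hc' h
  · refine isRieszBasis_of_synthesis_bijective hH hT ⟨?_, hsurj⟩
    rw [injective_iff_map_eq_zero]
    intro c hc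
    -- an element of the kernel is the coefficient sequence of some `v`, whose expansion sums to
    -- both `v` and `0`
    have hmem : (fun n => c n) ∈ extendedMomentSpace 𝕜 x := by
      rw [h]
      exact lp_two_summable c
    simp only [extendedMomentSpace, Set.mem_iUnion] at hmem
    obtain ⟨y, hy, v, hv⟩ := hmem
    have hv' : ∀ n, c n = inner 𝕜 (y n) v := congrFun hv
    have h1 := (hT c).tendsto_sum_nat
    simp only [hv'] at h1
    have hv0 : v = 0 := (tendsto_nhds_unique (hy v) h1).trans hc
    ext n
    rw [hv' n, hv0, inner_zero_right]
    rfl
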